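/- Let $\mathbb{F}$ be a field of characteristic $0$. For integers $n,m\ge 0$ let $R(n,m)\subseteq \mathbb{F}[x^{(k)}_{i,j} : 1\le k\le m,\ 1\le i,j\le n]$ be the ring of matrix semi-invariants, that is, the $\mathbb{F}$-algebra of all polynomials on $m$-tuples of $n\times n$ matrices that are invariant under $(B_1,\dots,B_m)\mapsto (AB_1C^{-1},\dots,AB_mC^{-1})$ for all $(A,C)\in \mathrm{SL}(n,\mathbb{F})\times \mathrm{SL}(n,\mathbb{F})$. Let $\beta(R(n,m))$ be the smallest integer $D$ such that the elements of $R(n,m)$ of degree at most $D$ generate $R(n,m)$ as an $\mathbb{F}$-algebra. Then, as long as the number $m$ of matrices is at least of order $n^{3/2}$ (in particular for all $m\ge n^2$), if $R(n,m)$ is generated by its elements of degree at most $bn$, then $b=\Omega(n^{1/2})$; that is, $\beta(R(n,m))=\Omega(n^{3/2})$. Precisely: for every real $\varepsilon>0$ there is a real constant $c>0$, depending only on $\varepsilon$, such that for every field $\mathbb{F}$ of characteristic $0$ and all integers $n,m\ge 0$ with $m\ge \varepsilon\, n^{3/2}$: 1. for every integer $b\ge 0$, if $R(n,m)$ is generated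 by its elements of degree at most $bn$, then $b\ge c\, n^{1/2}$; 2. $\beta(R(n,m))\ge c\, n^{3/2}$. -/

import Mathlib

open scoped ENNReal

noncomputable section

/-- The polynomial ring `F[x_{i,j}^{(k)}]`, `k ∈ [m]`, `i, j ∈ [n]`: polynomial functions on
`m`-tuples of `n × n` matrices. The variable `x_{i,j}^{(k)}` has index `(k, i, j)`. -/
abbrev MatPoly (F : Type*) [Field F] (n m : ℕ) : Type _ :=
  MvPolynomial (Fin m × Fin n × Fin n) F

/-- The `k`-th generic matrix `X_k = (x_{i,j}^{(k)})`. -/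
def genericMat (F : Type*) [Field F] (n m : ℕ) (k : Fin m) :
    Matrix (Fin n) (Fin n) (MatPoly F n m) :=
  Matrix.of fun i j => MvPolynomial.X (k, i, j)

/-- The substitution `f(X_1, …, X_m) ↦ f(A X_1 C⁻¹, …, A X_m C⁻¹)`. -/
def leftRightSubst (F : Type*) [Field F] (n m : ℕ)
    (A C : Matrix.SpecialLinearGroup (Fin n) F) : MatPoly F n m →ₐ[F] MatPoly F n m :=
  MvPolynomial.aeval fun v : Fin m × Fin n × Fin n =>
    ((A : Matrix (Fin n) (Fin n) F).map MvPolynomial.C * genericMat F n m v.1 *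
      ((C⁻¹ : Matrix.SpecialLinearGroup (Fin n) F) : Matrix (Fin n) (Fin n) F).map
        MvPolynomial.C : Matrix (Fin n) (Fin n) (MatPoly F n m)) v.2.1 v.2.2

/-- The ring `R(n, m)` of matrix semi-invariants: polynomials invariant under
`(B_1, …, B_m) ↦ (A B_1 C⁻¹, …, A B_m C⁻¹)` for all `(A, C) ∈ SL(n, F) × SL(n, F)`. -/
def matrixSemiInvariants (F : Type*) [Field F] (n m : ℕ) : Subalgebra F (MatPoly F n m) :=
  ⨅ (A : Matrix.SpecialLinearGroup (Fin n) F) (C : Matrix.SpecialLinearGroup (Fin n) F),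
    AlgHom.equalizer (leftRightSubst F n m A C) (AlgHom.id F (MatPoly F n m))

/-- `R(n, m)` is generated, as an `F`-algebra, by its elements of degree at most `D`. -/
def GeneratedInDegree (F : Type*) [Field F] (n m D : ℕ) : Prop :=
  Algebra.adjoin F {f : MatPoly F n m | f ∈ matrixSemiInvariants F n m ∧ f.totalDegree ≤ D} =
    matrixSemiInvariants F n m

/-- `β(R(n, m))`: the smallest `D` such that `R(n, m)` is generated by its elements of degree at
most `D` (by convention `⊤` if there were no such `D`). -/
def betaSemiInv (F : Type*) [Field F] (n m : ℕ) : ℕ∞ :=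
  ⨅ (D : ℕ) (_ : GeneratedInDegree F n m D), (D : ℕ∞)

end

/-! The proof compares dimensions in one multilinear component, of degree `d * n` in `d * n`
distinct matrices, with `d` of order `√n`; this is why `m` must be at least of order `n ^ (3/2)`.

By the first fundamental theorem for `SL n`, applied on the left and on the right, the
semi-invariants of degree `b * n` are spanned by the polynomials `bracketPoly`, each given by two
tableaux with `b` columns of height `n` on the same set of positions
(`mem_span_bracketPoly_of_relative_invariant`). Suppose degree at most `D` suffices, and put `b = D
/ n`. Then every semi-invariant is a combination of products of such polynomials with at most `b`
columns each. In a product the columns can be numbered block after block, so the two column labels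
of each position differ by less than `b` (`mem_span_bandPolys`). A product of brackets depends, up
to sign, only on its column labels, so the component has dimension at most `(d * (2 * b)) ^ (d * n)`
(`finrank_multilinearCoeff_bandPolys_le`).

On the other side, permuting the entries along the `T = n + 1 - d` full diagonals of a `d`-column
tableau gives `d! ^ T` independent products of brackets, hence dimension at least `(d! ^ T) ^ 2`
(`le_finrank_multilinearCoeff`). Since `d! ≥ (d / 3) ^ d` and `d * d ≤ n`, the two bounds force `d ≤
72 * b` (`le_mul_of_factorial_pow_le`). -/

/-! ### Levi-Civita symbols and products of brackets. -/

/-- The Levi-Civita symbol of a self-map of `Fin n`. -/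
def leviCivita {n : ℕ} (g : Fin n → Fin n) : ℤ :=
  Matrix.det (Matrix.of fun r c => if g r = c then (1 : ℤ) else 0)

/-- The tensor of a product of brackets, one bracket for each column of the tableau `e`. -/
def bracketTensor {S B : Type*} [Fintype B] {n : ℕ} (e : S ≃ B × Fin n) (i : S → Fin n) : ℤ :=
  ∏ a, leviCivita fun r => i (e.symm (a, r))

theorem leviCivita_id {n : ℕ} : leviCivita (fun r : Fin n => r) = 1 := by
  have : (Matrix.of fun r c : Fin n => if r = c then (1 : ℤ) else 0) = 1 := by
    ext r c; simp [Matrix.one_apply]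
  rw [leviCivita, this, Matrix.det_one]

theorem injective_of_leviCivita_ne_zero {n : ℕ} {g : Fin n → Fin n} (h : leviCivita g ≠ 0) :
    Function.Injective g := by
  intro r r' hr
  by_contra hne
  exact h (Matrix.det_zero_of_row_eq hne (by ext c; simp [hr]))

theorem leviCivita_comp_perm {n : ℕ} (g : Fin n → Fin n) (σ : Equiv.Perm (Fin n)) :
    leviCivita (fun r => g (σ r)) = Equiv.Perm.sign σ * leviCivita g := by
  exact Matrix.det_permute σ (Matrix.of fun r c => if g r = c then (1 : ℤ) else 0)

theorem det_submatrix_eq_leviCivita_mul {R : Type*} [CommRing R] {n : ℕ}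
    (M : Matrix (Fin n) (Fin n) R) (g : Fin n → Fin n) :
    Matrix.det (Matrix.of fun r c => M (g r) c) = (leviCivita g : R) * M.det := by
  have h1 : ((leviCivita g : ℤ) : R) =
      Matrix.det (Matrix.of fun r c => if g r = c then (1 : R) else 0) := by
    rw [leviCivita, ← eq_intCast (Int.castRingHom R), RingHom.map_det]
    congr 1
    ext r c
    by_cases h : g r = c <;> simp [h]
  rw [h1, ← Matrix.det_mul]
  congr 1
  ext r c
  simp [Matrix.mul_apply]

theorem sum_leviCivita_mul_prod {R : Type*} [CommRing R] {n : ℕ} (M : Matrix (Fin n) (Fin n) R) :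
    ∑ g : Fin n → Fin n, (leviCivita g : R) * ∏ r, M r (g r) = M.det := by
  have h1 : ∀ g : Fin n → Fin n, (leviCivita g : R) =
      Matrix.detRowAlternating (fun r => (Pi.single (g r) 1 : Fin n → R)) := by
    intro g
    have := det_submatrix_eq_leviCivita_mul (1 : Matrix (Fin n) (Fin n) R) g
    rw [Matrix.det_one, mul_one] at this
    rw [← this]
    change _ = Matrix.det _
    congr 1
    ext r c
    simp [Matrix.one_apply, Pi.single_apply, eq_comm]
  have h2 : M.det = (Matrix.detRowAlternating (R := R) (n := Fin n)).toMultilinearMap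
      (fun r => ∑ c, M r c • (Pi.single c 1 : Fin n → R)) := by
    change _ = Matrix.det _
    congr 1
    ext r c
    simp [Finset.sum_apply, Pi.single_apply]
  rw [h2, MultilinearMap.map_sum]
  refine Finset.sum_congr rfl fun g _ => ?_
  rw [MultilinearMap.map_smul_univ, h1, smul_eq_mul, mul_comm]
  rfl

theorem bracketTensor_comp {S S' B : Type*} [Fintype B] {n : ℕ} (e : S ≃ B × Fin n)
    (h : S' ≃ S) (i : S → Fin n) :
    bracketTensor (h.trans e) (fun s => i (h s)) = bracketTensor e i := by
  simp [bracketTensor]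

section Tensor

variable {S B : Type*} [Fintype S] [Fintype B] [DecidableEq S] {n : ℕ}

theorem sum_bracketTensor_mul_prod {R : Type*} [CommRing R] (e : S ≃ B × Fin n)
    (y : S → Fin n → R) :
    ∑ i : S → Fin n, (bracketTensor e i : R) * ∏ s, y s (i s) =
      ∏ a, Matrix.det (Matrix.of fun r c => y (e.symm (a, r)) c) := by
  classical
  simp_rw [← sum_leviCivita_mul_prod]
  rw [Finset.prod_univ_sum, Fintype.piFinset_univ]
  let E : (S → Fin n) ≃ (B → Fin n → Fin n) :=
    (Equiv.arrowCongr e (Equiv.refl _)).trans (Equiv.curry _ _ _)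
  refine Fintype.sum_equiv E _ _ fun i => ?_
  rw [Finset.prod_mul_distrib, bracketTensor, Int.cast_prod]
  congr 1
  rw [← Fintype.prod_prod_type', ← Equiv.prod_comp e.symm]
  rfl

theorem sum_bracketTensor_mul_prod_mul {R : Type*} [CommRing R] (e : S ≃ B × Fin n)
    (A : Matrix (Fin n) (Fin n) R) (y : S → Fin n → R) :
    ∑ i : S → Fin n, (bracketTensor e i : R) * ∏ s, (A.mulVec (y s)) (i s) =
      A.det ^ Fintype.card B * ∑ i : S → Fin n, (bracketTensor e i : R) * ∏ s, y s (i s) := by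
  rw [sum_bracketTensor_mul_prod, sum_bracketTensor_mul_prod, ← Finset.card_univ,
    ← Finset.prod_const, ← Finset.prod_mul_distrib]
  refine Finset.prod_congr rfl fun a _ => ?_
  rw [← Matrix.det_transpose A, mul_comm, ← Matrix.det_mul]
  congr 1
  ext r c
  simp [Matrix.mul_apply, Matrix.mulVec, dotProduct, mul_comm]

theorem sum_bracketTensor_mul_prod_rows {R : Type*} [CommRing R] (e : S ≃ B × Fin n)
    (M : Matrix (Fin n) (Fin n) R) (i' : S → Fin n) :
    ∑ i : S → Fin n, (bracketTensor e i : R) * ∏ s, M (i' s) (i s) =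
      bracketTensor e i' * M.det ^ Fintype.card B := by
  rw [sum_bracketTensor_mul_prod e fun s => M (i' s), bracketTensor, Int.cast_prod,
    ← Finset.card_univ, ← Finset.prod_const, ← Finset.prod_mul_distrib]
  exact Finset.prod_congr rfl fun a _ => det_submatrix_eq_leviCivita_mul M _

/-- The Gram kernel of all products of brackets on the tensor positions `S`. -/
def bracketKernel (S B : Type*) [Fintype S] [Fintype B] [DecidableEq S] [DecidableEq B] {n : ℕ}
    (i' i : S → Fin n) : ℤ :=
  ∑ e : S ≃ B × Fin n, bracketTensor e i' * bracketTensor e i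

/-- Permuting positions only reindexes the sum over all tableaux. This symmetry lets the kernel
define a functional on commutative monomials. -/
theorem bracketKernel_comp_perm [DecidableEq B] (h : Equiv.Perm S) (i' i : S → Fin n) :
    bracketKernel S B (fun s => i' (h s)) (fun s => i (h s)) = bracketKernel S B i' i := by
  rw [bracketKernel, bracketKernel]
  refine (Fintype.sum_equiv (Equiv.equivCongr h.symm (Equiv.refl _)) _ _ fun e => ?_).symm
  have : (Equiv.equivCongr h.symm (Equiv.refl _)) e = h.trans e := by ext s <;> simp
  rw [this, bracketTensor_comp, bracketTensor_comp]

end Tensor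

/-! ### The first fundamental theorem for `SL n`. -/

theorem exists_equiv_of_sum_single_eq {S S' V : Type*} [Fintype S] [Fintype S']
    (g : S → V) (g' : S' → V)
    (h : ∑ s, Finsupp.single (g s) 1 = ∑ s, (Finsupp.single (g' s) 1 : V →₀ ℕ)) :
    ∃ E : S ≃ S', ∀ s, g' (E s) = g s := by
  classical
  have key : ∀ v, Nonempty ({s // g s = v} ≃ {s // g' s = v}) := by
    intro v
    rw [← Fintype.card_eq]
    have := DFunLike.congr_fun h v
    simp only [Finsupp.finsetSum_apply, Finsupp.single_apply, Finset.sum_boole] at this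
    simpa [Fintype.card_subtype] using this
  exact ⟨Equiv.ofFiberEquiv fun v => (key v).some, fun s => Equiv.ofFiberEquiv_map _ s⟩

theorem prod_X_eq_monomial {R S V : Type*} [CommSemiring R] [Fintype S] (g : S → V) :
    ∏ s, (MvPolynomial.X (g s) : MvPolynomial V R) =
      MvPolynomial.monomial (∑ s, Finsupp.single (g s) 1) 1 := by
  rw [MvPolynomial.monomial_sum_one]
  rfl

/-- Two words with the same commutative monomial differ by a permutation of positions, so `k`
descends to monomials; any value will do on the others. -/
theorem exists_functional_of_symmetric {F S V : Type*} [Field F] [Fintype S] (k : (S → V) → F)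
    (hk : ∀ (g : S → V) (h : Equiv.Perm S), k (fun s => g (h s)) = k g) :
    ∃ Θ : MvPolynomial V F →ₗ[F] F, ∀ g : S → V, Θ (∏ s, MvPolynomial.X (g s)) = k g := by
  classical
  refine ⟨(MvPolynomial.basisMonomials V F).constr F fun α =>
    if h : ∃ g : S → V, ∑ s, Finsupp.single (g s) 1 = α then k h.choose else 0, fun g => ?_⟩
  rw [prod_X_eq_monomial, ← congrFun (MvPolynomial.coe_basisMonomials V F) _,
    Module.Basis.constr_basis]
  have h : ∃ g' : S → V, ∑ s, Finsupp.single (g' s) 1 = ∑ s, (Finsupp.single (g s) 1 : V →₀ ℕ) :=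
    ⟨g, rfl⟩
  rw [dif_pos h]
  obtain ⟨E, hE⟩ := exists_equiv_of_sum_single_eq _ _ h.choose_spec
  rw [← hk g E]
  exact congrArg k (funext fun s => (hE s).symm)

/-- The first fundamental theorem for `SL n` acting on vectors, in tensor form. -/
theorem exists_const_of_relative_invariant (F : Type*) [Field F] [CharZero F] (b n : ℕ) :
    ∃ c : F, ∀ (Q : Type*) [Fintype Q]
      (φ : Q → (Fin b × Fin n → Fin n) → F) (y : Q → Fin b × Fin n → Fin n → F),
      (∀ A : Matrix (Fin n) (Fin n) F, A.det ≠ 0 →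
        ∑ q, ∑ i, φ q i * ∏ s, (A.mulVec (y q s)) (i s) =
          A.det ^ b * ∑ q, ∑ i, φ q i * ∏ s, y q s (i s)) →
      ∑ q, ∑ i, φ q i * ∏ s, y q s (i s) =
        c * ∑ q, ∑ i, (∑ i', (bracketKernel (Fin b × Fin n) (Fin b) i' i : F) * φ q i') *
          ∏ s, y q s (i s) := by
  classical
  let e₀ : Fin b × Fin n ≃ Fin b × Fin n := Equiv.refl _
  -- `Θ` below replaces averaging over the group: it sends the monomial of entries `(i' s, i s)` to
  -- the kernel. `M` and `c₁` record its value on a power of the determinant, `Θ (M * det ^ b) =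
  -- c₁`. As a sum of squares with a positive term, `c₁` is nonzero in characteristic `0`.
  let M : ℤ := ∑ i, bracketTensor e₀ i * bracketTensor e₀ i
  let c₁ : ℤ := ∑ i', ∑ i, bracketTensor e₀ i' * bracketTensor e₀ i *
    bracketKernel (Fin b × Fin n) (Fin b) i' i
  have hc₁ : c₁ = ∑ e : Fin b × Fin n ≃ Fin b × Fin n,
      (∑ i, bracketTensor e₀ i * bracketTensor e i) ^ 2 := by
    simp only [c₁, bracketKernel, Finset.mul_sum, sq, Finset.sum_mul]
    rw [Finset.sum_comm' (t' := Finset.univ) (s' := fun _ => Finset.univ) (by simp)]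
    conv_rhs => rw [Finset.sum_comm]
    refine Finset.sum_congr rfl fun i _ => ?_
    rw [Finset.sum_comm]
    refine Finset.sum_congr rfl fun e _ => Finset.sum_congr rfl fun i' _ => ?_
    ring
  have hM : 0 < M := by
    refine Finset.sum_pos' (fun i _ => mul_self_nonneg _) ⟨Prod.snd, Finset.mem_univ _, ?_⟩
    simp [bracketTensor, e₀, leviCivita_id]
  have hc₁' : 0 < c₁ := by
    rw [hc₁]
    exact Finset.sum_pos' (fun i _ => sq_nonneg _) ⟨e₀, Finset.mem_univ _, pow_pos hM 2⟩
  obtain ⟨Θ, hΘ⟩ := exists_functional_of_symmetric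
    (fun g : Fin b × Fin n → Fin n × Fin n =>
      ((bracketKernel (Fin b × Fin n) (Fin b) (fun s => (g s).1) (fun s => (g s).2) : ℤ) : F))
    (fun g h => by
      congr 1
      exact bracketKernel_comp_perm h (fun s => (g s).1) (fun s => (g s).2))
  let Z : Matrix (Fin n) (Fin n) (MvPolynomial (Fin n × Fin n) F) :=
    Matrix.mvPolynomialX (Fin n) (Fin n) F
  have hdet : Θ (MvPolynomial.C (M : F) * Z.det ^ b) = c₁ := by
    have h1 : MvPolynomial.C (M : F) * Z.det ^ b =
        ∑ i', ∑ i, ((bracketTensor e₀ i' * bracketTensor e₀ i : ℤ) : F) •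
          ∏ s, MvPolynomial.X ((i' s, i s) : Fin n × Fin n) := by
      have h2 : ∀ i' : Fin b × Fin n → Fin n,
          ∑ i, ((bracketTensor e₀ i' * bracketTensor e₀ i : ℤ) : F) • ∏ s,
            (MvPolynomial.X ((i' s, i s) : Fin n × Fin n) : MvPolynomial (Fin n × Fin n) F) =
          ((bracketTensor e₀ i' * bracketTensor e₀ i' : ℤ) : MvPolynomial (Fin n × Fin n) F)
            * Z.det ^ b := by
        intro i'
        have := sum_bracketTensor_mul_prod_rows e₀ Z i'
        rw [Fintype.card_fin] at this
        rw [Int.cast_mul, mul_assoc, ← this, Finset.mul_sum]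
        refine Finset.sum_congr rfl fun i _ => ?_
        rw [MvPolynomial.smul_eq_C_mul, map_intCast, Int.cast_mul, mul_assoc]
        rfl
      simp_rw [h2]
      rw [← Finset.sum_mul, map_intCast]
      push_cast [M]
      rfl
    rw [h1]
    simp only [map_sum, map_smul, hΘ, c₁, smul_eq_mul]
    push_cast
    rfl
  refine ⟨M / c₁, fun Q _ φ y H => ?_⟩
  set Ψ := ∑ q, ∑ i, φ q i * ∏ s, y q s (i s) with hΨ
  have hF : (c₁ : F) ≠ 0 := by exact_mod_cast hc₁'.ne'
  -- `p` is the form evaluated at the vectors `Z y` for the generic matrix `Z`. Relative invariance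
  -- makes it `Ψ * det Z ^ b`, while expanding `Θ p` monomial by monomial produces the kernel;
  -- comparing the two gives the identity.
  let p : MvPolynomial (Fin n × Fin n) F :=
    ∑ q, ∑ i' : Fin b × Fin n → Fin n, ∑ i : Fin b × Fin n → Fin n,
      (φ q i' * ∏ s, y q s (i s)) • ∏ s, MvPolynomial.X ((i' s, i s) : Fin n × Fin n)
  have hp : p = MvPolynomial.C Ψ * Z.det ^ b := by
    -- The hypothesis covers invertible matrices only; the extra factor `Z.det` makes both sides
    -- vanish at the singular ones.
    have h0 : Z.det ≠ 0 := Matrix.det_mvPolynomialX_ne_zero _ _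
    refine mul_right_cancel₀ h0 (MvPolynomial.funext fun a => ?_)
    let A : Matrix (Fin n) (Fin n) F := Matrix.of fun r c => a (r, c)
    have hA : MvPolynomial.eval a Z.det = A.det := by
      rw [RingHom.map_det]
      congr 1
      ext r c
      simp [Z, A, Matrix.mvPolynomialX]
    rw [map_mul, map_mul, map_mul, map_pow, hA, MvPolynomial.eval_C]
    by_cases hz : A.det = 0
    · simp [hz]
    · rw [mul_comm Ψ, ← H A hz]
      congr 1
      simp only [p, map_sum, MvPolynomial.smul_eval, map_prod, MvPolynomial.eval_X]
      refine Finset.sum_congr rfl fun q _ => Finset.sum_congr rfl fun i' _ => ?_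
      simp only [Matrix.mulVec, dotProduct]
      rw [Finset.prod_univ_sum, Fintype.piFinset_univ, Finset.mul_sum]
      refine Finset.sum_congr rfl fun i _ => ?_
      rw [Finset.prod_mul_distrib]
      simp only [A, Matrix.of_apply]
      ring
  have h3 : Θ (MvPolynomial.C (M : F) * p) = Ψ * c₁ := by
    rw [← hdet, hp, mul_left_comm, ← MvPolynomial.smul_eq_C_mul _ Ψ, map_smul, smul_eq_mul]
  have h4 : Θ p = ∑ q, ∑ i, (∑ i', (bracketKernel (Fin b × Fin n) (Fin b) i' i : F) * φ q i') *
          ∏ s, y q s (i s) := by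
    simp only [p, map_sum, map_smul, hΘ, smul_eq_mul]
    refine Finset.sum_congr rfl fun q _ => ?_
    rw [Finset.sum_comm]
    refine Finset.sum_congr rfl fun i _ => ?_
    rw [Finset.sum_mul]
    exact Finset.sum_congr rfl fun i' _ => by ring
  rw [← h4, div_mul_eq_mul_div, eq_div_iff hF, ← h3, ← MvPolynomial.smul_eq_C_mul, map_smul,
    smul_eq_mul]

/-! ### Bracket polynomials of matrix tuples and their multilinear coefficients. -/

theorem bracketTensor_trans_prodCongr {S B B' : Type*} [Fintype B] [Fintype B'] {n : ℕ}
    (e : S ≃ B × Fin n) (τ : B ≃ B') (i : S → Fin n) :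
    bracketTensor (e.trans (τ.prodCongr (Equiv.refl _))) i = bracketTensor e i := by
  rw [bracketTensor, bracketTensor, ← Equiv.prod_comp τ]
  simp

theorem bracketTensor_sumCongr {S S' B B' : Type*} [Fintype B] [Fintype B'] {n : ℕ}
    (e : S ≃ B × Fin n) (e' : S' ≃ B' × Fin n) (i : S ⊕ S' → Fin n) :
    bracketTensor ((e.sumCongr e').trans (Equiv.sumProdDistrib _ _ _).symm) i =
      bracketTensor e (fun s => i (Sum.inl s)) * bracketTensor e' (fun s => i (Sum.inr s)) := by
  rw [bracketTensor, Fintype.prod_sum_type]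
  rfl

theorem sum_sum_elim {S S' T R : Type*} [Fintype S] [Fintype S'] [DecidableEq S] [DecidableEq S']
    [Fintype T] [AddCommMonoid R] (f : (S ⊕ S' → T) → R) :
    ∑ i, f i = ∑ i, ∑ i', f (Sum.elim i i') := by
  rw [← Fintype.sum_prod_type', ← Equiv.sum_comp (Equiv.sumArrowEquivProdArrow S S' T).symm]
  rfl

section BracketPoly

variable {S B : Type*} [Fintype S] [Fintype B] [DecidableEq S] {n m : ℕ}

/-- The contraction of a family of matrices with two products of brackets. -/
def bracketForm {R : Type*} [CommRing R] (e e' : S ≃ B × Fin n)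
    (G : S → Matrix (Fin n) (Fin n) R) : R :=
  ∑ i : S → Fin n, ∑ j : S → Fin n,
    ((bracketTensor e i * bracketTensor e' j : ℤ) : R) * ∏ s, G s (i s) (j s)

theorem bracketForm_transpose {R : Type*} [CommRing R] (e e' : S ≃ B × Fin n)
    (G : S → Matrix (Fin n) (Fin n) R) :
    bracketForm e e' (fun s => (G s).transpose) = bracketForm e' e G := by
  rw [bracketForm, bracketForm, Finset.sum_comm]
  refine Finset.sum_congr rfl fun i _ => Finset.sum_congr rfl fun j _ => ?_
  rw [mul_comm (bracketTensor e j)]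
  rfl

theorem bracketForm_mul_left {R : Type*} [CommRing R] (e e' : S ≃ B × Fin n)
    (A : Matrix (Fin n) (Fin n) R) (G : S → Matrix (Fin n) (Fin n) R) :
    bracketForm e e' (fun s => A * G s) = A.det ^ Fintype.card B * bracketForm e e' G := by
  have h : ∀ G : S → Matrix (Fin n) (Fin n) R, bracketForm e e' G =
      ∑ j, (bracketTensor e' j : R) * ∑ i, (bracketTensor e i : R) * ∏ s, G s (i s) (j s) := by
    intro G
    rw [bracketForm, Finset.sum_comm]
    refine Finset.sum_congr rfl fun j _ => ?_
    rw [Finset.mul_sum]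
    exact Finset.sum_congr rfl fun i _ => by push_cast; ring
  rw [h, h, Finset.mul_sum]
  refine Finset.sum_congr rfl fun j _ => ?_
  rw [mul_left_comm, ← sum_bracketTensor_mul_prod_mul e A fun s r => G s r (j s)]
  rfl

theorem bracketForm_mul_right {R : Type*} [CommRing R] (e e' : S ≃ B × Fin n)
    (C : Matrix (Fin n) (Fin n) R) (G : S → Matrix (Fin n) (Fin n) R) :
    bracketForm e e' (fun s => G s * C) = C.det ^ Fintype.card B * bracketForm e e' G := by
  rw [← bracketForm_transpose]
  simp_rw [Matrix.transpose_mul]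
  rw [bracketForm_mul_left, bracketForm_transpose, Matrix.det_transpose]

theorem map_bracketForm {R R' : Type*} [CommRing R] [CommRing R'] (f : R →+* R')
    (e e' : S ≃ B × Fin n) (G : S → Matrix (Fin n) (Fin n) R) :
    f (bracketForm e e' G) = bracketForm e e' fun s => (G s).map f := by
  simp [bracketForm, map_sum, map_prod]

/-- The polynomial obtained by contracting the generic matrices `X_{κ s}` with two products of
brackets. -/
noncomputable def bracketPoly (F : Type*) [Field F] (κ : S → Fin m) (e e' : S ≃ B × Fin n) :
    MatPoly F n m :=
  bracketForm e e' fun s => genericMat F n m (κ s)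

theorem genericMat_map_leftRightSubst (F : Type*) [Field F] (n m : ℕ)
    (A C : Matrix.SpecialLinearGroup (Fin n) F) (k : Fin m) :
    (genericMat F n m k).map (leftRightSubst F n m A C) =
      (A : Matrix (Fin n) (Fin n) F).map MvPolynomial.C * genericMat F n m k *
        ((C⁻¹ : Matrix.SpecialLinearGroup (Fin n) F) : Matrix (Fin n) (Fin n) F).map
          MvPolynomial.C := by
  ext i j
  simp [genericMat, leftRightSubst]

theorem mem_matrixSemiInvariants_iff {F : Type*} [Field F] {f : MatPoly F n m} :
    f ∈ matrixSemiInvariants F n m ↔ ∀ A C, leftRightSubst F n m A C f = f := by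
  simp [matrixSemiInvariants, Algebra.mem_iInf, AlgHom.mem_equalizer]

theorem bracketPoly_mem_matrixSemiInvariants (F : Type*) [Field F] (κ : S → Fin m)
    (e e' : S ≃ B × Fin n) : bracketPoly F κ e e' ∈ matrixSemiInvariants F n m := by
  rw [mem_matrixSemiInvariants_iff]
  intro A C
  have hdet : ∀ T : Matrix.SpecialLinearGroup (Fin n) F,
      ((T : Matrix (Fin n) (Fin n) F).map
        (MvPolynomial.C : F →+* MatPoly F n m)).det = 1 := by
    intro T
    have := (RingHom.map_det (MvPolynomial.C : F →+* MatPoly F n m)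
      (T : Matrix (Fin n) (Fin n) F)).symm
    rw [T.det_coe, map_one] at this
    exact this
  have h1 := map_bracketForm (leftRightSubst F n m A C : MatPoly F n m →+* MatPoly F n m) e e'
    fun s => genericMat F n m (κ s)
  have h2 : ∀ s, (genericMat F n m (κ s)).map
      (leftRightSubst F n m A C : MatPoly F n m →+* MatPoly F n m) = _ :=
    fun s => genericMat_map_leftRightSubst F n m A C (κ s)
  simp only [h2] at h1
  rw [bracketForm_mul_right, bracketForm_mul_left, hdet, hdet, one_pow, one_mul, one_mul] at h1
  exact h1

theorem bracketPoly_comp {F : Type*} [Field F] {S' : Type*} [Fintype S'] [DecidableEq S']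
    (κ : S → Fin m) (e e' : S ≃ B × Fin n) (h : S' ≃ S) :
    bracketPoly F (fun s => κ (h s)) (h.trans e) (h.trans e') = bracketPoly F κ e e' := by
  rw [bracketPoly, bracketPoly, bracketForm, bracketForm]
  refine (Fintype.sum_equiv (Equiv.arrowCongr h.symm (Equiv.refl _)) _ _ fun i =>
    Fintype.sum_equiv (Equiv.arrowCongr h.symm (Equiv.refl _)) _ _ fun j => ?_).symm
  have : ∀ i : S → Fin n, (Equiv.arrowCongr h.symm (Equiv.refl (Fin n))) i = fun s => i (h s) :=
    fun i => rfl
  rw [this, this, bracketTensor_comp, bracketTensor_comp, ← Equiv.prod_comp h]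

theorem bracketPoly_trans_prodCongr {F : Type*} [Field F] {B' : Type*} [Fintype B']
    (κ : S → Fin m) (e e' : S ≃ B × Fin n) (τ : B ≃ B') :
    bracketPoly F κ (e.trans (τ.prodCongr (Equiv.refl _)))
      (e'.trans (τ.prodCongr (Equiv.refl _))) = bracketPoly F κ e e' := by
  simp only [bracketPoly, bracketForm, bracketTensor_trans_prodCongr]

theorem bracketPoly_sumCongr {F : Type*} [Field F] {S' B' : Type*} [Fintype S'] [DecidableEq S']
    [Fintype B'] (κ : S → Fin m) (κ' : S' → Fin m) (e₁ e₂ : S ≃ B × Fin n)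
    (e₁' e₂' : S' ≃ B' × Fin n) :
    bracketPoly F (Sum.elim κ κ') ((e₁.sumCongr e₁').trans (Equiv.sumProdDistrib _ _ _).symm)
      ((e₂.sumCongr e₂').trans (Equiv.sumProdDistrib _ _ _).symm) =
      bracketPoly F κ e₁ e₂ * bracketPoly F κ' e₁' e₂' := by
  simp only [bracketPoly, bracketForm]
  rw [sum_sum_elim, Finset.sum_mul_sum]
  refine Finset.sum_congr rfl fun i _ => Finset.sum_congr rfl fun i' _ => ?_
  rw [sum_sum_elim, Finset.sum_mul_sum]
  refine Finset.sum_congr rfl fun j _ => Finset.sum_congr rfl fun j' _ => ?_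
  rw [bracketTensor_sumCongr, bracketTensor_sumCongr, Fintype.prod_sum_type]
  simp only [Sum.elim_inl, Sum.elim_inr]
  push_cast
  ring

/-- The multilinear coefficient of `bracketPoly`. -/
theorem coeff_bracketPoly {F : Type*} [Field F] (ι : S → Fin m) (hι : Function.Injective ι)
    (e e' : S ≃ B × Fin n) (i j : S → Fin n) :
    (bracketPoly F ι e e').coeff (∑ s, Finsupp.single (ι s, i s, j s) 1) =
      ((bracketTensor e i * bracketTensor e' j : ℤ) : F) := by
  classical
  have h0 : ∀ i' j' : S → Fin n, ((∑ s, Finsupp.single (ι s, i' s, j' s) 1 :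
      Fin m × Fin n × Fin n →₀ ℕ) = ∑ s, Finsupp.single (ι s, i s, j s) 1) ↔ i' = i ∧ j' = j := by
    refine fun i' j' => ⟨fun h => ?_, by rintro ⟨rfl, rfl⟩; rfl⟩
    obtain ⟨E, hE⟩ := exists_equiv_of_sum_single_eq _ _ h
    -- Distinct positions carry distinct matrices, so the monomial remembers the whole word and
    -- there is no collision between terms.
    have hE' : ∀ s, E s = s := fun s => hι (congrArg Prod.fst (hE s))
    simp only [hE', Prod.mk.injEq, true_and] at hE
    exact ⟨funext fun s => (hE s).1.symm, funext fun s => (hE s).2.symm⟩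
  simp only [bracketPoly, bracketForm, genericMat, Matrix.of_apply, MvPolynomial.coeff_sum]
  have h1 : ∀ i' j' : S → Fin n, MvPolynomial.coeff (∑ s, Finsupp.single (ι s, i s, j s) 1)
      (((bracketTensor e i' * bracketTensor e' j' : ℤ) : MatPoly F n m) *
        ∏ s, MvPolynomial.X (ι s, i' s, j' s)) =
      if i' = i ∧ j' = j then ((bracketTensor e i' * bracketTensor e' j' : ℤ) : F) else 0 := by
    intro i' j'
    rw [prod_X_eq_monomial fun s => (ι s, i' s, j' s), ← map_intCast (MvPolynomial.C (R := F)),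
      MvPolynomial.coeff_C_mul, MvPolynomial.coeff_monomial]
    simp only [h0]
    simp
  simp only [h1, ite_and]
  simp

theorem exists_equiv_of_coeff_bracketPoly_ne_zero {F : Type*} [Field F] {S' : Type*} [Fintype S']
    (κ : S → Fin m) (e e' : S ≃ B × Fin n) (ι : S' → Fin m) (i j : S' → Fin n)
    (h : (bracketPoly F κ e e').coeff (∑ s, Finsupp.single (ι s, i s, j s) 1) ≠ 0) :
    ∃ E : S' ≃ S, ∀ s, κ (E s) = ι s := by
  classical
  simp only [bracketPoly, bracketForm, genericMat, Matrix.of_apply, MvPolynomial.coeff_sum] at h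
  obtain ⟨i', -, h⟩ := Finset.exists_ne_zero_of_sum_ne_zero h
  obtain ⟨j', -, h⟩ := Finset.exists_ne_zero_of_sum_ne_zero h
  rw [prod_X_eq_monomial fun s => (κ s, i' s, j' s), ← map_intCast (MvPolynomial.C (R := F)),
    MvPolynomial.coeff_C_mul, MvPolynomial.coeff_monomial] at h
  have h' := (ite_ne_right_iff.mp (right_ne_zero_of_mul h)).1
  obtain ⟨E, hE⟩ := exists_equiv_of_sum_single_eq _ _ h'.symm
  exact ⟨E, fun s => congrArg Prod.fst (hE s)⟩

end BracketPoly

/-! ### Homogeneous polynomials and torus weights. -/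

section Homogeneous

variable {F V : Type*} [Field F] [Fintype V]

theorem sum_eq_of_isHomogeneous {f : MvPolynomial V F} {N : ℕ} (hf : f.IsHomogeneous N)
    {α : V →₀ ℕ} (hα : f.coeff α ≠ 0) : ∑ v, α v = N := by
  rw [← hf hα, ← Finsupp.degree_eq_sum]
  exact DFunLike.congr_fun Finsupp.degree_eq_weight_one α

theorem coeff_aeval_C_mul_X (t : V → F) (f : MvPolynomial V F) (α : V →₀ ℕ) :
    (MvPolynomial.aeval (fun v => MvPolynomial.C (t v) * MvPolynomial.X v) f :
      MvPolynomial V F).coeff α = (∏ v, t v ^ α v) * f.coeff α := by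
  classical
  induction f using MvPolynomial.induction_on' with
  | monomial β c =>
    have : (MvPolynomial.aeval (fun v => MvPolynomial.C (t v) * MvPolynomial.X v)
        (MvPolynomial.monomial β c) : MvPolynomial V F) =
        MvPolynomial.monomial β ((∏ v, t v ^ β v) * c) := by
      rw [MvPolynomial.aeval_monomial, Finsupp.prod_fintype _ _ (by simp)]
      simp only [mul_pow, Finset.prod_mul_distrib]
      rw [MvPolynomial.monomial_eq, Finsupp.prod_fintype _ _ (by simp)]
      simp only [map_mul, map_prod, map_pow, MvPolynomial.algebraMap_eq]
      ring
    rw [this, MvPolynomial.coeff_monomial, MvPolynomial.coeff_monomial]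
    split_ifs with h
    · rw [h]
    · simp
  | add p q hp hq => rw [map_add, MvPolynomial.coeff_add, hp, hq, MvPolynomial.coeff_add, mul_add]

theorem prod_comp_pow_eq {n : ℕ} (pr : V → Fin n) (a : Fin n → F) (α : V →₀ ℕ) :
    ∏ v, a (pr v) ^ α v = ∏ i, a i ^ (∑ v with pr v = i, α v) := by
  rw [← Finset.prod_fiberwise (s := Finset.univ) (g := pr)]
  refine Finset.prod_congr rfl fun i _ => ?_
  rw [← Finset.prod_pow_eq_pow_sum]
  exact Finset.prod_congr rfl fun v hv => by rw [(Finset.mem_filter.mp hv).2]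

theorem sum_fiber_eq_of_torus_invariant [CharZero F] {n : ℕ} (pr : V → Fin n)
    (f : MvPolynomial V F)
    (hf : ∀ a : Fin n → F, ∏ i, a i = 1 →
      MvPolynomial.aeval (fun v => MvPolynomial.C (a (pr v)) * MvPolynomial.X v) f = f)
    (α : V →₀ ℕ) (hα : f.coeff α ≠ 0) (i i' : Fin n) :
    ∑ v with pr v = i, α v = ∑ v with pr v = i', α v := by
  by_cases hi : i = i'
  · rw [hi]
  -- One torus element of determinant `1` is enough: it scales the monomial by `2` to the difference
  -- of the two fiber degrees, and powers of `2` are distinct in characteristic `0`.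
  let a : Fin n → F := Function.update (Function.update 1 i 2) i' 2⁻¹
  have hprod : ∀ r : Fin n → ℕ, ∏ k, a k ^ r k = 2 ^ r i * 2⁻¹ ^ r i' := by
    intro r
    rw [← Finset.prod_subset (Finset.subset_univ {i, i'}), Finset.prod_pair hi]
    · simp [a, Function.update_of_ne hi]
    · intro k _ hk
      simp only [Finset.mem_insert, Finset.mem_singleton, not_or] at hk
      simp [a, Function.update_of_ne hk.1, Function.update_of_ne hk.2]
  have h1 : ∏ k, a k = 1 := by
    have := hprod 1
    simpa using this
  have h2 := coeff_aeval_C_mul_X (fun v => a (pr v)) f α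
  rw [hf a h1, prod_comp_pow_eq, hprod, inv_pow] at h2
  have h3 := (mul_eq_right₀ hα).mp h2.symm
  rw [mul_inv_eq_one₀ (pow_ne_zero _ two_ne_zero)] at h3
  have h4 : (2 : ℕ) ^ (∑ v with pr v = i, α v) = 2 ^ (∑ v with pr v = i', α v) := by
    exact_mod_cast h3
  exact Nat.pow_right_injective le_rfl h4

/-- Each monomial has the same degree in all `n` fibers of `pr`. That common degree is `N / n`,
independent of the monomial, so the whole torus acts by a power of the determinant. -/
theorem exists_weight_of_torus_invariant [CharZero F] {n : ℕ} (hn : 0 < n) (pr : V → Fin n)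
    {f : MvPolynomial V F} {N : ℕ} (hN : f.IsHomogeneous N) (h0 : f ≠ 0)
    (hf : ∀ a : Fin n → F, ∏ i, a i = 1 →
      MvPolynomial.aeval (fun v => MvPolynomial.C (a (pr v)) * MvPolynomial.X v) f = f) :
    ∃ b : ℕ, N = b * n ∧ ∀ a : Fin n → F,
      MvPolynomial.aeval (fun v => MvPolynomial.C (a (pr v)) * MvPolynomial.X v) f =
        MvPolynomial.C ((∏ i, a i) ^ b) * f := by
  have key : ∀ α, f.coeff α ≠ 0 → ∀ i, N = (∑ v with pr v = i, α v) * n := by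
    intro α hα i
    have h1 : ∑ v, α v = N := sum_eq_of_isHomogeneous hN hα
    rw [← h1, ← Finset.sum_fiberwise (s := Finset.univ) (g := pr),
      Finset.sum_congr rfl fun j _ => sum_fiber_eq_of_torus_invariant pr f hf α hα j i]
    simp [mul_comm]
  obtain ⟨β, hβ⟩ := MvPolynomial.ne_zero_iff.mp h0
  refine ⟨_, key β hβ ⟨0, hn⟩, fun a => ?_⟩
  ext α
  rw [coeff_aeval_C_mul_X (fun v => a (pr v)), MvPolynomial.coeff_C_mul]
  by_cases hα : f.coeff α = 0
  · simp [hα]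
  · rw [prod_comp_pow_eq, ← Finset.prod_pow]
    congr 1
    refine Finset.prod_congr rfl fun i _ => ?_
    rw [Nat.eq_of_mul_eq_mul_right hn ((key α hα i).symm.trans (key β hβ ⟨0, hn⟩))]

theorem exists_sum_prod_X_of_isHomogeneous {S : Type*} [Fintype S] [DecidableEq S]
    {f : MvPolynomial V F}
    (hf : f.IsHomogeneous (Fintype.card S)) :
    ∃ φ : (S → V) → F, f = ∑ g, φ g • ∏ s, MvPolynomial.X (g s) := by
  classical
  suffices h : f ∈ Submodule.span F
      (Set.range fun g : S → V => ∏ s, (MvPolynomial.X (g s) : MvPolynomial V F)) by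
    obtain ⟨φ, hφ⟩ := (Submodule.mem_span_range_iff_exists_fun F).mp h
    exact ⟨φ, hφ.symm⟩
  rw [f.as_sum]
  refine Submodule.sum_mem _ fun α hα => ?_
  have hdeg : ∑ v, α v = Fintype.card S :=
    sum_eq_of_isHomogeneous hf (MvPolynomial.mem_support_iff.mp hα)
  have hcard : Fintype.card S = Fintype.card (Σ v, Fin (α v)) := by
    simp [← hdeg]
  let E := Fintype.equivOfCardEq hcard
  have hg : ∑ s, Finsupp.single (E s).1 1 = α := by
    rw [Equiv.sum_comp E fun x => (Finsupp.single x.1 1 : V →₀ ℕ), Fintype.sum_sigma]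
    ext v
    simp
  have : MvPolynomial.monomial α (f.coeff α) =
      f.coeff α • ∏ s, (MvPolynomial.X (E s).1 : MvPolynomial V F) := by
    rw [prod_X_eq_monomial, hg, MvPolynomial.smul_monomial, smul_eq_mul, mul_one]
  rw [this]
  exact Submodule.smul_mem _ _ (Submodule.subset_span ⟨fun s => (E s).1, rfl⟩)

end Homogeneous

/-! ### From `SL n`-invariance to relative `GL n`-invariance. -/

section SemiInvariants

variable {F : Type*} [Field F] {n m : ℕ}

/-- Evaluation of a polynomial at a tuple of matrices. -/
noncomputable def evalMat (X : Fin m → Matrix (Fin n) (Fin n) F) : MatPoly F n m →ₐ[F] F :=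
  MvPolynomial.aeval fun v => X v.1 v.2.1 v.2.2

theorem evalMat_leftRightSubst (X : Fin m → Matrix (Fin n) (Fin n) F)
    (A C : Matrix.SpecialLinearGroup (Fin n) F) (f : MatPoly F n m) :
    evalMat X (leftRightSubst F n m A C f) =
      evalMat (fun k => (A : Matrix (Fin n) (Fin n) F) * X k *
        ((C⁻¹ : Matrix.SpecialLinearGroup (Fin n) F) : Matrix (Fin n) (Fin n) F)) f := by
  rw [evalMat, leftRightSubst, ← AlgHom.comp_apply, MvPolynomial.comp_aeval, evalMat]
  congr 2
  ext v
  simp [genericMat, Matrix.mul_apply, Finset.sum_mul]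

theorem evalMat_diagonal_mul (X : Fin m → Matrix (Fin n) (Fin n) F) (a : Fin n → F)
    (f : MatPoly F n m) :
    evalMat (fun k => Matrix.diagonal a * X k) f = evalMat X
      (MvPolynomial.aeval (fun v => MvPolynomial.C (a v.2.1) * MvPolynomial.X v) f) := by
  rw [evalMat, evalMat, ← AlgHom.comp_apply, MvPolynomial.comp_aeval]
  congr 2
  ext v
  simp

theorem evalMat_mul_diagonal (X : Fin m → Matrix (Fin n) (Fin n) F) (a : Fin n → F)
    (f : MatPoly F n m) :
    evalMat (fun k => X k * Matrix.diagonal a) f = evalMat X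
      (MvPolynomial.aeval (fun v => MvPolynomial.C (a v.2.2) * MvPolynomial.X v) f) := by
  rw [evalMat, evalMat, ← AlgHom.comp_apply, MvPolynomial.comp_aeval]
  congr 2
  ext v
  simp [mul_comm]

theorem evalMat_ext [CharZero F] {f g : MatPoly F n m} (h : ∀ X, evalMat X f = evalMat X g) :
    f = g := by
  refine MvPolynomial.funext fun x => ?_
  have := h fun k => Matrix.of fun i j => x (k, i, j)
  rwa [evalMat, MvPolynomial.aeval_eq_eval] at this

/-- Putting the determinant in a single diagonal entry avoids extracting `n`-th roots, so the field
need not be algebraically closed. -/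
theorem exists_eq_diagonal_mul (hn : 0 < n) (A : Matrix (Fin n) (Fin n) F) (hA : A.det ≠ 0) :
    ∃ (a : Fin n → F) (A' : Matrix.SpecialLinearGroup (Fin n) F), ∏ i, a i = A.det ∧
      A = Matrix.diagonal a * (A' : Matrix (Fin n) (Fin n) F) := by
  let i₀ : Fin n := ⟨0, hn⟩
  let a : Fin n → F := Function.update 1 i₀ A.det
  have ha : ∏ i, a i = A.det := by
    rw [Finset.prod_update_of_mem (Finset.mem_univ _)]
    simp
  have hne : ∀ i, a i ≠ 0 := by
    intro i
    by_cases h : i = i₀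
    · subst h; simpa [a] using hA
    · simp [a, Function.update_of_ne h]
  refine ⟨a, ⟨Matrix.diagonal (fun i => (a i)⁻¹) * A, ?_⟩, ha, ?_⟩
  · rw [Matrix.det_mul, Matrix.det_diagonal, Finset.prod_inv_distrib, ha, inv_mul_cancel₀ hA]
  · change _ = Matrix.diagonal a * (Matrix.diagonal (fun i => (a i)⁻¹) * A)
    rw [← Matrix.mul_assoc, Matrix.diagonal_mul_diagonal]
    simp [hne]

theorem evalMat_mul_of_mem [CharZero F] {f : MatPoly F n m} (hf : f ∈ matrixSemiInvariants F n m)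
    (A C : Matrix.SpecialLinearGroup (Fin n) F) (X : Fin m → Matrix (Fin n) (Fin n) F) :
    evalMat (fun k => (A : Matrix (Fin n) (Fin n) F) * X k * (C : Matrix (Fin n) (Fin n) F)) f =
      evalMat X f := by
  have := evalMat_leftRightSubst X A C⁻¹ f
  rw [mem_matrixSemiInvariants_iff.mp hf, inv_inv] at this
  exact this.symm

theorem evalMat_mul_left_of_mem [CharZero F] {f : MatPoly F n m}
    (hf : f ∈ matrixSemiInvariants F n m)
    (A : Matrix.SpecialLinearGroup (Fin n) F) (X : Fin m → Matrix (Fin n) (Fin n) F) :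
    evalMat (fun k => (A : Matrix (Fin n) (Fin n) F) * X k) f = evalMat X f := by
  simpa using evalMat_mul_of_mem hf A 1 X

theorem evalMat_mul_right_of_mem [CharZero F] {f : MatPoly F n m}
    (hf : f ∈ matrixSemiInvariants F n m)
    (C : Matrix.SpecialLinearGroup (Fin n) F) (X : Fin m → Matrix (Fin n) (Fin n) F) :
    evalMat (fun k => X k * (C : Matrix (Fin n) (Fin n) F)) f = evalMat X f := by
  simpa using evalMat_mul_of_mem hf 1 C X

/-- A homogeneous semi-invariant is relatively invariant under `GL n × GL n`. -/
theorem exists_weight_of_mem_matrixSemiInvariants [CharZero F] (hn : 0 < n) {f : MatPoly F n m}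
    {N : ℕ} (hf : f ∈ matrixSemiInvariants F n m) (hN : f.IsHomogeneous N) (h0 : f ≠ 0) :
    ∃ b : ℕ, N = b * n ∧
      (∀ (A : Matrix (Fin n) (Fin n) F) X, A.det ≠ 0 →
        evalMat (fun k => A * X k) f = A.det ^ b * evalMat X f) ∧
      (∀ (C : Matrix (Fin n) (Fin n) F) X, C.det ≠ 0 →
        evalMat (fun k => X k * C) f = C.det ^ b * evalMat X f) := by
  obtain ⟨b, hb, hl⟩ := exists_weight_of_torus_invariant hn (fun v => v.2.1) hN h0 (by
    intro a ha
    refine evalMat_ext fun X => ?_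
    rw [← evalMat_diagonal_mul]
    exact evalMat_mul_left_of_mem hf ⟨Matrix.diagonal a, by rw [Matrix.det_diagonal, ha]⟩ X)
  obtain ⟨b', hb', hr⟩ := exists_weight_of_torus_invariant hn (fun v => v.2.2) hN h0 (by
    intro a ha
    refine evalMat_ext fun X => ?_
    rw [← evalMat_mul_diagonal]
    exact evalMat_mul_right_of_mem hf ⟨Matrix.diagonal a, by rw [Matrix.det_diagonal, ha]⟩ X)
  obtain rfl : b = b' := Nat.eq_of_mul_eq_mul_right hn (hb.symm.trans hb')
  refine ⟨b, hb, fun A X hA => ?_, fun C X hC => ?_⟩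
  · obtain ⟨a, A', ha, hAA⟩ := exists_eq_diagonal_mul hn A hA
    have : (fun k => A * X k) =
        fun k => Matrix.diagonal a * ((A' : Matrix (Fin n) (Fin n) F) * X k) := by
      funext k
      rw [← Matrix.mul_assoc, ← hAA]
    rw [this, evalMat_diagonal_mul, hl, map_mul, evalMat_mul_left_of_mem hf, ha]
    congr 1
    simp [evalMat]
  · obtain ⟨a, C', ha, hCC⟩ := exists_eq_diagonal_mul hn C.transpose
      (by rwa [Matrix.det_transpose])
    have : (fun k => X k * C) =
        fun k => (X k * (C'.transpose : Matrix (Fin n) (Fin n) F)) * Matrix.diagonal a := by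
      funext k
      rw [Matrix.mul_assoc, ← Matrix.diagonal_transpose a,
        Matrix.SpecialLinearGroup.coe_transpose, ← Matrix.transpose_mul, ← hCC,
        Matrix.transpose_transpose]
    rw [this, evalMat_mul_diagonal, hr, map_mul, evalMat_mul_right_of_mem hf, ha,
      Matrix.det_transpose]
    congr 1
    simp [evalMat]

/-- The substitution sends variables to linear forms, hence respects the grading. -/
theorem homogeneousComponent_mem_matrixSemiInvariants {f : MatPoly F n m}
    (hf : f ∈ matrixSemiInvariants F n m) (N : ℕ) :
    MvPolynomial.homogeneousComponent N f ∈ matrixSemiInvariants F n m := by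
  rw [mem_matrixSemiInvariants_iff] at hf ⊢
  intro A C
  have hg : ∀ v, (leftRightSubst F n m A C (MvPolynomial.X v)).IsHomogeneous 1 := by
    intro v
    simp only [leftRightSubst, MvPolynomial.aeval_X, Matrix.mul_apply, genericMat, Matrix.of_apply,
      Matrix.map_apply, Finset.sum_mul]
    refine MvPolynomial.IsHomogeneous.sum _ _ _ fun c _ =>
      MvPolynomial.IsHomogeneous.sum _ _ _ fun r _ => ?_
    rw [show (1 : ℕ) = 0 + 1 + 0 from rfl]
    exact ((MvPolynomial.isHomogeneous_C _ _).mul (MvPolynomial.isHomogeneous_X _ _)).mul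
      (MvPolynomial.isHomogeneous_C _ _)
  have hh : ∀ i, (leftRightSubst F n m A C
      (MvPolynomial.homogeneousComponent i f)).IsHomogeneous i := by
    intro i
    have := (MvPolynomial.homogeneousComponent_isHomogeneous i f).aeval
      (fun v => leftRightSubst F n m A C (MvPolynomial.X v)) hg
    rw [one_mul] at this
    convert this using 1
    exact (DFunLike.congr_fun (MvPolynomial.aeval_unique (leftRightSubst F n m A C)) _)
  conv_rhs => rw [← hf A C]
  conv_rhs => rw [← MvPolynomial.sum_homogeneousComponent f]
  rw [map_sum, map_sum]
  simp only [fun i => MvPolynomial.homogeneousComponent_of_mem (m := N) (hh i)]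
  rw [Finset.sum_ite_eq]
  split_ifs with h
  · rfl
  · rw [MvPolynomial.homogeneousComponent_eq_zero _ _ (by simpa using h), map_zero]

end SemiInvariants

/-! ### The spanning theorem and its consequence for bounded generation. -/

section

variable {F : Type*} [Field F] {n m : ℕ}

theorem evalMat_bracketPoly {S B : Type*} [Fintype S] [Fintype B] [DecidableEq S]
    (X : Fin m → Matrix (Fin n) (Fin n) F) (κ : S → Fin m) (e e' : S ≃ B × Fin n) :
    evalMat X (bracketPoly F κ e e') = ∑ i : S → Fin n, ∑ j : S → Fin n,
      ((bracketTensor e i : F) * bracketTensor e' j) * ∏ s, X (κ s) (i s) (j s) := by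
  simp [evalMat, bracketPoly, bracketForm, genericMat, map_sum, map_prod]

/-- The spanning theorem for matrix semi-invariants, from the first fundamental theorem applied
on both sides. -/
theorem mem_span_bracketPoly_of_relative_invariant [CharZero F] {f : MatPoly F n m} {b : ℕ}
    (hf : f.IsHomogeneous (b * n))
    (hl : ∀ (A : Matrix (Fin n) (Fin n) F) X, A.det ≠ 0 →
        evalMat (fun k => A * X k) f = A.det ^ b * evalMat X f)
    (hr : ∀ (C : Matrix (Fin n) (Fin n) F) X, C.det ≠ 0 →
        evalMat (fun k => X k * C) f = C.det ^ b * evalMat X f) :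
    f ∈ Submodule.span F {p | ∃ (κ : Fin b × Fin n → Fin m)
      (e e' : Fin b × Fin n ≃ Fin b × Fin n), p = bracketPoly F κ e e'} := by
  classical
  obtain ⟨c, hc⟩ := exists_const_of_relative_invariant F b n
  obtain ⟨φ', hφ'⟩ := exists_sum_prod_X_of_isHomogeneous (S := Fin b × Fin n) (f := f)
    (by simpa using hf)
  let K : (Fin b × Fin n → Fin n) → (Fin b × Fin n → Fin n) → F :=
    fun i' i => (bracketKernel (Fin b × Fin n) (Fin b) i' i : F)
  let φ : (Fin b × Fin n → Fin m) → (Fin b × Fin n → Fin n) → (Fin b × Fin n → Fin n) → F :=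
    fun κ i j => φ' fun s => (κ s, i s, j s)
  -- For the left action the matrix labels and column indices are frozen in the parameter `q`, and
  -- the column vectors of the `X k` are acted on. The right action is treated the same way in `h3`,
  -- with row indices frozen and the coefficients of `h2` as input.
  have h1 : ∀ X, evalMat X f = ∑ q : (Fin b × Fin n → Fin m) × (Fin b × Fin n → Fin n),
      ∑ i, φ q.1 i q.2 * ∏ s, X (q.1 s) (i s) (q.2 s) := by
    intro X
    have h := congrArg (evalMat X) hφ'
    rw [h]
    simp only [map_sum, map_smul, map_prod, evalMat, MvPolynomial.aeval_X, smul_eq_mul]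
    rw [← Fintype.sum_prod_type']
    let E : (Fin b × Fin n → Fin m × Fin n × Fin n) ≃
        ((Fin b × Fin n → Fin m) × (Fin b × Fin n → Fin n)) × (Fin b × Fin n → Fin n) :=
      { toFun := fun g => ((fun s => (g s).1, fun s => (g s).2.2), fun s => (g s).2.1)
        invFun := fun q s => (q.1.1 s, q.2 s, q.1.2 s)
        left_inv := fun g => rfl
        right_inv := fun q => rfl }
    exact Fintype.sum_equiv E _ _ fun g => rfl
  have h2 : ∀ X, evalMat X f = ∑ q : (Fin b × Fin n → Fin m) × (Fin b × Fin n → Fin n),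
      ∑ j, (c * ∑ i', K i' q.2 * φ q.1 i' j) * ∏ s, X (q.1 s) (q.2 s) (j s) := by
    intro X
    have := hc _ (fun q i => φ q.1 i q.2) (fun (q : (Fin b × Fin n → Fin m) ×
      (Fin b × Fin n → Fin n)) s r => X (q.1 s) r (q.2 s)) (by
        intro A hA
        rw [← h1, ← hl A X hA, h1]
        rfl)
    rw [h1, this, Fintype.sum_prod_type, Fintype.sum_prod_type, Finset.mul_sum]
    refine Finset.sum_congr rfl fun κ _ => ?_
    rw [Finset.sum_comm, Finset.mul_sum]
    refine Finset.sum_congr rfl fun i _ => ?_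
    rw [Finset.mul_sum]
    exact Finset.sum_congr rfl fun j _ => by rw [mul_assoc]
  have h3 : ∀ X, evalMat X f = c * ∑ q : (Fin b × Fin n → Fin m) × (Fin b × Fin n → Fin n),
      ∑ j, (∑ j', K j' j * (c * ∑ i', K i' q.2 * φ q.1 i' j')) *
        ∏ s, X (q.1 s) (q.2 s) (j s) := by
    intro X
    have := hc _ (fun q j => c * ∑ i', K i' q.2 * φ q.1 i' j) (fun (q : (Fin b × Fin n → Fin m) ×
      (Fin b × Fin n → Fin n)) s r => X (q.1 s) (q.2 s) r) (by
        intro C hC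
        rw [← h2]
        have := hr C.transpose X (by rwa [Matrix.det_transpose])
        rw [Matrix.det_transpose] at this
        rw [← this, h2]
        refine Finset.sum_congr rfl fun q _ => Finset.sum_congr rfl fun j _ => ?_
        congr 1
        refine Finset.prod_congr rfl fun s _ => ?_
        simp [Matrix.mulVec, dotProduct, Matrix.mul_apply, mul_comm])
    rw [h2, this]
  let coef : (Fin b × Fin n → Fin m) → (Fin b × Fin n ≃ Fin b × Fin n) →
      (Fin b × Fin n ≃ Fin b × Fin n) → F := fun κ e e' =>
    c * c * ∑ j', ∑ i', ((bracketTensor e i' : F) * bracketTensor e' j') * φ κ i' j'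
  have h4 : f = ∑ κ, ∑ e, ∑ e', coef κ e e' • bracketPoly F κ e e' := by
    refine evalMat_ext fun X => ?_
    rw [h3, Fintype.sum_prod_type, Finset.mul_sum]
    simp only [map_sum, map_smul, evalMat_bracketPoly, smul_eq_mul]
    refine Finset.sum_congr rfl fun κ _ => ?_
    have h5 : ∀ i j, c * (∑ j', K j' j * (c * ∑ i', K i' i * φ κ i' j')) =
        ∑ e, ∑ e', coef κ e e' * ((bracketTensor e i : F) * bracketTensor e' j) := by
      intro i j
      have h6 : ∀ j', K j' j * (c * ∑ i', K i' i * φ κ i' j') =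
          ∑ e : Fin b × Fin n ≃ Fin b × Fin n, ∑ e' : Fin b × Fin n ≃ Fin b × Fin n,
            c * ∑ i', ((bracketTensor e i' : F) * bracketTensor e' j') * φ κ i' j' *
              ((bracketTensor e i : F) * bracketTensor e' j) := by
        intro j'
        have h7 : ∀ e e' : Fin b × Fin n ≃ Fin b × Fin n,
            c * ∑ i', ((bracketTensor e i' : F) * bracketTensor e' j') * φ κ i' j' *
              ((bracketTensor e i : F) * bracketTensor e' j) =
            ((bracketTensor e' j' : F) * bracketTensor e' j) *
              (c * ∑ i', (bracketTensor e i' : F) * bracketTensor e i * φ κ i' j') := by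
          intro e e'
          rw [mul_left_comm, Finset.mul_sum (a := (bracketTensor e' j' : F) * _)]
          congr 1
          exact Finset.sum_congr rfl fun i' _ => by ring
        simp_rw [h7]
        rw [Finset.sum_comm]
        simp_rw [← Finset.mul_sum]
        rw [← Finset.sum_mul, Finset.sum_comm]
        simp only [K, bracketKernel, Int.cast_sum, Int.cast_mul, Finset.sum_mul]
      simp only [h6, coef]
      rw [Finset.sum_comm, Finset.mul_sum]
      refine Finset.sum_congr rfl fun e _ => ?_
      rw [Finset.sum_comm, Finset.mul_sum]
      refine Finset.sum_congr rfl fun e' _ => ?_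
      rw [Finset.mul_sum, Finset.mul_sum, Finset.sum_mul]
      refine Finset.sum_congr rfl fun j' _ => ?_
      rw [Finset.mul_sum, Finset.mul_sum, Finset.mul_sum, Finset.sum_mul]
      exact Finset.sum_congr rfl fun i' _ => by ring
    calc c * ∑ i, ∑ j, (∑ j', K j' j * (c * ∑ i', K i' i * φ κ i' j')) *
            ∏ s, X (κ s) (i s) (j s)
        = ∑ i, ∑ j, ∑ e, ∑ e', (coef κ e e' * ((bracketTensor e i : F) * bracketTensor e' j)) *
            ∏ s, X (κ s) (i s) (j s) := by
          rw [Finset.mul_sum]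
          refine Finset.sum_congr rfl fun i _ => ?_
          rw [Finset.mul_sum]
          refine Finset.sum_congr rfl fun j _ => ?_
          rw [← mul_assoc, h5, Finset.sum_mul]
          exact Finset.sum_congr rfl fun e _ => Finset.sum_mul _ _ _
      _ = ∑ i, ∑ e, ∑ e', ∑ j, (coef κ e e' * ((bracketTensor e i : F) * bracketTensor e' j)) *
            ∏ s, X (κ s) (i s) (j s) := by
          refine Finset.sum_congr rfl fun i _ => ?_
          rw [Finset.sum_comm]
          exact Finset.sum_congr rfl fun e _ => Finset.sum_comm
      _ = ∑ e, ∑ e', ∑ i, ∑ j, (coef κ e e' * ((bracketTensor e i : F) * bracketTensor e' j)) *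
            ∏ s, X (κ s) (i s) (j s) := by
          rw [Finset.sum_comm]
          exact Finset.sum_congr rfl fun e _ => Finset.sum_comm
      _ = _ := by
          simp only [mul_assoc, Finset.mul_sum]
  rw [h4]
  exact Submodule.sum_mem _ fun κ _ => Submodule.sum_mem _ fun e _ => Submodule.sum_mem _
    fun e' _ => Submodule.smul_mem _ _ (Submodule.subset_span ⟨κ, e, e', rfl⟩)

/-- The bracket polynomials all of whose positions have, in the two tableaux, column labels at
distance less than `b`. -/
def bandPolys (F : Type*) [Field F] (n m b : ℕ) : Submonoid (MatPoly F n m) where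
  carrier := {p | ∃ (N d : ℕ) (κ : Fin N → Fin m) (e e' : Fin N ≃ Fin d × Fin n),
    (∀ s, ((e s).1 : ℕ) < (e' s).1 + b ∧ ((e' s).1 : ℕ) < (e s).1 + b) ∧
      p = bracketPoly F κ e e'}
  one_mem' := by
    refine ⟨0, 0, Fin.elim0, Equiv.equivOfIsEmpty _ _, Equiv.equivOfIsEmpty _ _,
      fun s => s.elim0, ?_⟩
    simp [bracketPoly, bracketForm, bracketTensor]
  mul_mem' := by
    rintro _ _ ⟨N, d, κ, e₁, e₂, h, rfl⟩ ⟨N', d', κ', e₁', e₂', h', rfl⟩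
    -- The columns of the second factor are placed after those of the first, in both tableaux by the
    -- same shift, so label differences do not change.
    rw [← bracketPoly_sumCongr, ← bracketPoly_trans_prodCongr _ _ _ finSumFinEquiv,
      ← bracketPoly_comp _ _ _ finSumFinEquiv.symm]
    refine ⟨N + N', d + d', _, _, _, fun s => ?_, rfl⟩
    obtain ⟨s, rfl⟩ := finSumFinEquiv.surjective s
    rcases s with s | s
    · simpa [Equiv.sumProdDistrib] using h s
    · have := h' s
      simp [Equiv.sumProdDistrib]
      omega

theorem mem_span_bandPolys [CharZero F] (hn : 0 < n) {D : ℕ} (h : GeneratedInDegree F n m D)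
    {f : MatPoly F n m} (hf : f ∈ matrixSemiInvariants F n m) :
    f ∈ Submodule.span F (bandPolys F n m (D / n) : Set (MatPoly F n m)) := by
  rw [← Submonoid.closure_eq (bandPolys F n m (D / n)), ← Algebra.adjoin_eq_span]
  rw [← h] at hf
  refine Algebra.adjoin_le (fun g hg => ?_) hf
  obtain ⟨hg, hD⟩ := hg
  rw [SetLike.mem_coe, ← MvPolynomial.sum_homogeneousComponent g]
  refine Subalgebra.sum_mem _ fun N hN => ?_
  by_cases h0 : MvPolynomial.homogeneousComponent N g = 0
  · rw [h0]; exact Subalgebra.zero_mem _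
  have hhom := MvPolynomial.homogeneousComponent_isHomogeneous N g
  obtain ⟨b, rfl, hl, hr⟩ := exists_weight_of_mem_matrixSemiInvariants hn
    (homogeneousComponent_mem_matrixSemiInvariants hg N) hhom h0
  have hb : b ≤ D / n := by
    rw [Nat.le_div_iff_mul_le hn]
    have := Finset.mem_range.mp hN
    omega
  rw [← Subalgebra.mem_toSubmodule]
  refine Submodule.span_le.mpr ?_ (mem_span_bracketPoly_of_relative_invariant hhom hl hr)
  rintro _ ⟨κ, e, e', rfl⟩
  refine Algebra.subset_adjoin ?_
  rw [← bracketPoly_comp _ _ _ finProdFinEquiv.symm]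
  -- With only `b ≤ D / n` columns, any two labels are at distance less than `D / n`.
  refine ⟨b * n, b, _, _, _, fun s => ?_, rfl⟩
  have h1 := ((finProdFinEquiv.symm.trans e) s).1.2
  have h2 := ((finProdFinEquiv.symm.trans e') s).1.2
  omega

end

/-! ### Staircase permutations and a dual family of tableaux. -/

section Tableaux

variable {d T n : ℕ}

/-- The permutation of the positions of the `d`-column tableau which permutes, for each `t`, the
positions `(c, t + c)` by `ρ t` and fixes the positions off these staircases. -/
def staircasePerm (h : d + T = n + 1) (ρ : Fin T → Equiv.Perm (Fin d)) (x : Fin d × Fin n) :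
    Fin d × Fin n :=
  if hx : (x.1 : ℕ) ≤ x.2 ∧ (x.2 : ℕ) < x.1 + T then
    (ρ ⟨x.2 - x.1, by omega⟩ x.1,
      ⟨(x.2 - x.1 : ℕ) + ρ ⟨x.2 - x.1, by omega⟩ x.1, by
        have := (ρ ⟨x.2 - x.1, by omega⟩ x.1).2
        omega⟩)
  else x

theorem staircasePerm_add (h : d + T = n + 1) (ρ : Fin T → Equiv.Perm (Fin d)) (c : Fin d)
    (t : Fin T) :
    staircasePerm h ρ (c, ⟨t + c, by omega⟩) = (ρ t c, ⟨t + ρ t c, by omega⟩) := by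
  have hx : (c : ℕ) ≤ t + c ∧ (t + c : ℕ) < c + T := by omega
  have ht : (⟨t + c - c, by omega⟩ : Fin T) = t := by ext; simp
  simp only [staircasePerm, hx, and_self, dite_true, ht]
  simp

theorem staircasePerm_of_not (h : d + T = n + 1) (ρ : Fin T → Equiv.Perm (Fin d))
    (x : Fin d × Fin n) (hx : ¬((x.1 : ℕ) ≤ x.2 ∧ (x.2 : ℕ) < x.1 + T)) :
    staircasePerm h ρ x = x := by
  rw [staircasePerm, dif_neg hx]

theorem eq_add_of_staircase (x : Fin d × Fin n)
    (h : d + T = n + 1) (hx : (x.1 : ℕ) ≤ x.2 ∧ (x.2 : ℕ) < x.1 + T) :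
    ∃ (t : Fin T) (c : Fin d), x = (c, ⟨t + c, by clear hx; omega⟩) :=
  ⟨⟨x.2 - x.1, by omega⟩, x.1, by ext <;> simp; omega⟩

theorem staircasePerm_mul (h : d + T = n + 1) (ρ ρ' : Fin T → Equiv.Perm (Fin d))
    (x : Fin d × Fin n) :
    staircasePerm h ρ (staircasePerm h ρ' x) = staircasePerm h (ρ * ρ') x := by
  by_cases hx : (x.1 : ℕ) ≤ x.2 ∧ (x.2 : ℕ) < x.1 + T
  · obtain ⟨t, c, rfl⟩ := eq_add_of_staircase x h hx
    rw [staircasePerm_add, staircasePerm_add, staircasePerm_add]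
    rfl
  · rw [staircasePerm_of_not h ρ' x hx, staircasePerm_of_not h _ x hx,
      staircasePerm_of_not h _ x hx]

theorem staircasePerm_one (h : d + T = n + 1) (x : Fin d × Fin n) :
    staircasePerm h 1 x = x := by
  by_cases hx : (x.1 : ℕ) ≤ x.2 ∧ (x.2 : ℕ) < x.1 + T
  · obtain ⟨t, c, rfl⟩ := eq_add_of_staircase x h hx
    rw [staircasePerm_add]
    rfl
  · exact staircasePerm_of_not h _ x hx

/-- `staircasePerm` as an equivalence. -/
def staircaseEquiv (h : d + T = n + 1) (ρ : Fin T → Equiv.Perm (Fin d)) :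
    Fin d × Fin n ≃ Fin d × Fin n where
  toFun := staircasePerm h ρ
  invFun := staircasePerm h ρ⁻¹
  left_inv x := by rw [staircasePerm_mul, inv_mul_cancel, staircasePerm_one]
  right_inv x := by rw [staircasePerm_mul, mul_inv_cancel, staircasePerm_one]

/-- Induction on the column `k`. Once the earlier columns are fixed, each `ρ t` can only move `k`
upwards, so no row label in column `k` decreases. The labels still form a permutation of `Fin n`, so
their sum is unchanged and none increases either. -/
theorem eq_one_of_injective_staircasePerm (h : d + T = n + 1) (ρ : Fin T → Equiv.Perm (Fin d))
    (hρ : ∀ a, Function.Injective fun r => (staircasePerm h ρ (a, r)).2) : ρ = 1 := by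
  suffices key : ∀ (k : ℕ) (hk : k < d) (t : Fin T), ρ t ⟨k, hk⟩ = ⟨k, hk⟩ by
    funext t
    ext a
    rw [key a.1 a.2 t]
    rfl
  intro k
  induction k using Nat.strong_induction_on with
  | _ k ih =>
    intro hk t
    have hge : ∀ t, k ≤ (ρ t ⟨k, hk⟩ : ℕ) := by
      intro t
      by_contra hlt
      push Not at hlt
      have h1 := ih _ hlt (ρ t ⟨k, hk⟩).2 t
      have h2 := congrArg Fin.val ((ρ t).injective h1)
      simp only at h2
      omega
    have hle : ∀ r : Fin n, (r : ℕ) ≤ (staircasePerm h ρ (⟨k, hk⟩, r)).2 := by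
      intro r
      by_cases hx : k ≤ (r : ℕ) ∧ (r : ℕ) < k + T
      · obtain ⟨t, c, hc⟩ := eq_add_of_staircase (⟨k, hk⟩, r) h hx
        rw [hc, staircasePerm_add]
        have h1 := congrArg Fin.val (congrArg Prod.fst hc)
        have h2 := congrArg Fin.val (congrArg Prod.snd hc)
        have hc' : c = ⟨k, hk⟩ := (congrArg Prod.fst hc).symm
        subst hc'
        have := hge t
        simp only at h2 ⊢
        omega
      · rw [staircasePerm_of_not h ρ _ hx]
    have hsum : ∑ r : Fin n, (r : ℕ) =
        ∑ r : Fin n, ((staircasePerm h ρ (⟨k, hk⟩, r)).2 : ℕ) :=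
      ((hρ ⟨k, hk⟩).bijective_of_finite.sum_comp fun r : Fin n => (r : ℕ)).symm
    have heq := (Finset.sum_eq_sum_iff_of_le fun r _ => hle r).mp hsum
      ⟨t + k, by omega⟩ (Finset.mem_univ _)
    have h1 := staircasePerm_add h ρ ⟨k, hk⟩ t
    simp only at h1 heq
    rw [h1] at heq
    ext
    simp only at heq ⊢
    omega

theorem bracketTensor_staircaseEquiv (h : d + T = n + 1) (σ τ : Fin T → Equiv.Perm (Fin d)) :
    bracketTensor (staircaseEquiv h σ) (fun x => (staircaseEquiv h τ x).2) =
      if σ = τ then 1 else 0 := by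
  have h1 : ∀ x, staircaseEquiv h τ ((staircaseEquiv h σ).symm x) =
      staircasePerm h (τ * σ⁻¹) x := fun x => staircasePerm_mul h τ σ⁻¹ x
  simp only [bracketTensor, h1]
  split_ifs with heq
  · subst heq
    simp [staircasePerm_one, leviCivita_id]
  · by_contra hne
    refine heq ?_
    have := eq_one_of_injective_staircasePerm h (τ * σ⁻¹) fun a =>
      injective_of_leviCivita_ne_zero (Finset.prod_ne_zero_iff.mp hne a (Finset.mem_univ _))
    exact (mul_inv_eq_one.mp this).symm

end Tableaux

/-! ### Upper and lower bounds for the multilinear component. -/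

section Counting

theorem exists_bracketTensor_eq_mul {S B : Type*} [Fintype B] {n : ℕ} (e e₁ : S ≃ B × Fin n)
    (h : ∀ s, (e s).1 = (e₁ s).1) :
    ∃ c : ℤ, ∀ i : S → Fin n, bracketTensor e i = c * bracketTensor e₁ i := by
  have h1 : ∀ a r, e₁ (e.symm (a, r)) = (a, (e₁ (e.symm (a, r))).2) := by
    intro a r
    ext1
    · rw [← h]; simp
    · rfl
  have hinj : ∀ a, Function.Injective fun r => (e₁ (e.symm (a, r))).2 := by
    intro a r r' hr
    have : e₁ (e.symm (a, r)) = e₁ (e.symm (a, r')) := by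
      rw [h1, h1 a r']
      exact congrArg (Prod.mk a) hr
    simpa using this
  -- Tableaux with equal column labels differ by a permutation inside each column, which costs only
  -- a sign.
  let σ : B → Equiv.Perm (Fin n) := fun a => Equiv.ofBijective _ (hinj a).bijective_of_finite
  refine ⟨∏ a, (Equiv.Perm.sign (σ a) : ℤ), fun i => ?_⟩
  rw [bracketTensor, bracketTensor, ← Finset.prod_mul_distrib]
  refine Finset.prod_congr rfl fun a _ => ?_
  rw [← leviCivita_comp_perm]
  congr 1
  funext r
  congr 1
  rw [Equiv.eq_symm_apply, h1]
  rfl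

variable {F : Type*} [Field F] {n m d : ℕ}

/-- The multilinear coefficients, in the matrices selected by `ι`, of a polynomial. -/
noncomputable def multilinearCoeff (F : Type*) [Field F] {n m : ℕ} {S : Type*} [Fintype S]
    (ι : S → Fin m) : MatPoly F n m →ₗ[F] ((S → Fin n) × (S → Fin n) → F) :=
  LinearMap.pi fun q => MvPolynomial.lcoeff F (∑ s, Finsupp.single (ι s, q.1 s, q.2 s) 1)

/-- Pairs of labels at distance less than `b`. -/
abbrev BandPair (d b : ℕ) : Type :=
  {q : Fin d × Fin d // (q.1 : ℕ) < q.2 + b ∧ (q.2 : ℕ) < q.1 + b}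

theorem card_bandPair_le (d b : ℕ) : Fintype.card (BandPair d b) ≤ d * (2 * b) := by
  have : Fintype.card (BandPair d b) ≤ Fintype.card (Fin d × Fin (2 * b)) := by
    refine Fintype.card_le_of_injective
      -- A pair is encoded by its first label and the difference of labels, shifted by `b` to be a
      -- natural number below `2 * b`.
      (fun q => (q.1.1, ⟨q.1.2 + b - q.1.1, by have := q.2; omega⟩)) ?_
    rintro ⟨⟨p, q⟩, h⟩ ⟨⟨p', q'⟩, h'⟩ heq
    simp only [Prod.mk.injEq, Fin.mk.injEq] at heq
    obtain ⟨rfl, heq⟩ := heq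
    have : q = q' := by ext; simp only at h h'; omega
    subst this
    rfl
  simpa using this

theorem finrank_multilinearCoeff_bandPolys_le (hn : 0 < n) (b : ℕ) (ι : Fin d × Fin n → Fin m)
    (hι : Function.Injective ι) :
    Module.finrank F ((Submodule.span F (bandPolys F n m b : Set (MatPoly F n m))).map
      (multilinearCoeff F (n := n) ι)) ≤ (d * (2 * b)) ^ (d * n) := by
  classical
  -- One representative tableau per column labelling. Labellings that come from no tableau get a
  -- dummy value, harmless because only an upper bound on the number of vectors is needed.
  let e₀ : (Fin d × Fin n → Fin d) → (Fin d × Fin n ≃ Fin d × Fin n) := fun π =>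
    if h : ∃ e : Fin d × Fin n ≃ Fin d × Fin n, ∀ s, (e s).1 = π s then h.choose
    else Equiv.refl _
  have he₀ : ∀ e : Fin d × Fin n ≃ Fin d × Fin n, ∀ s,
      (e s).1 = (e₀ (fun s => (e s).1) s).1 := by
    intro e s
    have h : ∃ e' : Fin d × Fin n ≃ Fin d × Fin n, ∀ s, (e' s).1 = (e s).1 := ⟨e, fun _ => rfl⟩
    simp only [e₀, dif_pos h]
    exact (h.choose_spec s).symm
  let w : (Fin d × Fin n → BandPair d b) →
      ((Fin d × Fin n → Fin n) × (Fin d × Fin n → Fin n) → F) :=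
    fun π q => ((bracketTensor (e₀ fun s => (π s).1.1) q.1 *
      bracketTensor (e₀ fun s => (π s).1.2) q.2 : ℤ) : F)
  have hle : (Submodule.span F (bandPolys F n m b : Set (MatPoly F n m))).map
      (multilinearCoeff F (n := n) ι) ≤ Submodule.span F (Set.range w) := by
    rw [Submodule.map_span_le]
    rintro _ ⟨N, d', κ, e, e', hb, rfl⟩
    by_cases h0 : multilinearCoeff F (n := n) ι (bracketPoly F κ e e') = 0
    · rw [h0]; exact Submodule.zero_mem _
    obtain ⟨q, hq⟩ := Function.ne_iff.mp h0
    obtain ⟨E, hE⟩ := exists_equiv_of_coeff_bracketPoly_ne_zero κ e e' ι q.1 q.2 hq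
    have hd : d = d' := by
      have := Fintype.card_congr (E.trans e)
      simp only [Fintype.card_prod, Fintype.card_fin] at this
      exact Nat.eq_of_mul_eq_mul_right hn this
    subst hd
    rw [← bracketPoly_comp κ e e' E, show (fun s => κ (E s)) = ι from funext hE]
    obtain ⟨c, hc⟩ := exists_bracketTensor_eq_mul (E.trans e) _ (he₀ (E.trans e))
    obtain ⟨c', hc'⟩ := exists_bracketTensor_eq_mul (E.trans e') _ (he₀ (E.trans e'))
    have : multilinearCoeff F (n := n) ι (bracketPoly F ι (E.trans e) (E.trans e')) =
        ((c * c' : ℤ) : F) • w fun s => ⟨((E.trans e s).1, (E.trans e' s).1), hb (E s)⟩ := by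
      funext q
      have := coeff_bracketPoly (F := F) ι hι (E.trans e) (E.trans e') q.1 q.2
      rw [hc, hc'] at this
      refine this.trans ?_
      simp only [w, Pi.smul_apply, smul_eq_mul]
      push_cast
      ring
    rw [this]
    exact Submodule.smul_mem _ _ (Submodule.subset_span ⟨_, rfl⟩)
  refine (Submodule.finrank_mono hle).trans ((finrank_range_le_card w).trans ?_)
  rw [Fintype.card_fun, Fintype.card_prod, Fintype.card_fin, Fintype.card_fin]
  exact Nat.pow_le_pow_left (card_bandPair_le d b) _

/-- By `bracketTensor_staircaseEquiv`, the coefficients of the bracket polynomials of pairs of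
staircase tableaux, read at the matching pairs of words, form an identity matrix. -/
theorem le_finrank_multilinearCoeff {T : ℕ} (h : d + T = n + 1) (ι : Fin d × Fin n → Fin m)
    (hι : Function.Injective ι) :
    (d.factorial ^ T) ^ 2 ≤ Module.finrank F
      ((Subalgebra.toSubmodule (matrixSemiInvariants F n m)).map
        (multilinearCoeff F (n := n) ι)) := by
  classical
  let v : (Fin T → Equiv.Perm (Fin d)) × (Fin T → Equiv.Perm (Fin d)) →
      ((Fin d × Fin n → Fin n) × (Fin d × Fin n → Fin n) → F) := fun q =>
    multilinearCoeff F ι (bracketPoly F ι (staircaseEquiv h q.1) (staircaseEquiv h q.2))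
  have hv : ∀ q q' : (Fin T → Equiv.Perm (Fin d)) × (Fin T → Equiv.Perm (Fin d)),
      v q (fun x => (staircaseEquiv h q'.1 x).2, fun x => (staircaseEquiv h q'.2 x).2) =
        if q = q' then 1 else 0 := by
    intro q q'
    refine (coeff_bracketPoly ι hι _ _ _ _).trans ?_
    rw [bracketTensor_staircaseEquiv, bracketTensor_staircaseEquiv]
    by_cases h1 : q.1 = q'.1 <;> by_cases h2 : q.2 = q'.2 <;> simp [Prod.ext_iff, h1, h2]
  have hli : LinearIndependent F v := by
    rw [Fintype.linearIndependent_iff]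
    intro g hg q
    have := congrFun hg
      (fun x => (staircaseEquiv h q.1 x).2, fun x => (staircaseEquiv h q.2 x).2)
    simpa [Finset.sum_apply, hv] using this
  have hcard := finrank_span_eq_card hli
  have : (d.factorial ^ T) ^ 2 =
      Fintype.card ((Fin T → Equiv.Perm (Fin d)) × (Fin T → Equiv.Perm (Fin d))) := by
    simp [Fintype.card_perm, sq]
  rw [this, ← hcard]
  refine Submodule.finrank_mono (Submodule.span_le.mpr ?_)
  rintro _ ⟨q, rfl⟩
  exact Submodule.mem_map_of_mem (bracketPoly_mem_matrixSemiInvariants F ι _ _)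

theorem factorial_pow_le_of_generatedInDegree [CharZero F] (hn : 0 < n) {D : ℕ}
    (h : GeneratedInDegree F n m D) {T : ℕ} (hT : d + T = n + 1) (hm : d * n ≤ m) :
    (d.factorial ^ T) ^ 2 ≤ (d * (2 * (D / n))) ^ (d * n) := by
  let ι : Fin d × Fin n → Fin m := fun s => Fin.castLE hm (finProdFinEquiv s)
  have hι : Function.Injective ι :=
    (Fin.castLE_injective hm).comp finProdFinEquiv.injective
  refine (le_finrank_multilinearCoeff (F := F) hT ι hι).trans
    (le_trans (Submodule.finrank_mono (Submodule.map_mono ?_))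
      (finrank_multilinearCoeff_bandPolys_le hn (D / n) ι hι))
  exact fun f hf => mem_span_bandPolys hn h hf

/-- The determinant of a generic matrix is not constant, so degree less than `n` is not enough. -/
theorem one_le_div_of_generatedInDegree [CharZero F] (hn : 0 < n) (hm : 0 < m) {D : ℕ}
    (h : GeneratedInDegree F n m D) : 1 ≤ D / n := by
  by_contra hlt
  have hb : D / n = 0 := Nat.lt_one_iff.mp (not_le.mp hlt)
  let κ : Fin 1 × Fin n → Fin m := fun _ => ⟨0, hm⟩
  have hmem := mem_span_bandPolys hn h
    (bracketPoly_mem_matrixSemiInvariants F κ (Equiv.refl (Fin 1 × Fin n)) (Equiv.refl _))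
  rw [hb] at hmem
  -- For `b = 0` the band condition is contradictory at any position, so only the empty product
  -- remains. The one-column bracket polynomial is not constant: it vanishes at zero matrices, and
  -- at identity matrices it is a positive sum of squares.
  have hle : Submodule.span F (bandPolys F n m 0 : Set (MatPoly F n m)) ≤
      Submodule.span F {1} := by
    refine Submodule.span_le.mpr ?_
    rintro _ ⟨N, d, κ, e, e', h, rfl⟩
    rcases Nat.eq_zero_or_pos N with rfl | hN
    · have hd : d = 0 := by
        have := Fintype.card_congr e
        simp only [Fintype.card_prod, Fintype.card_fin] at this
        exact (Nat.mul_eq_zero.mp this.symm).resolve_right hn.ne'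
      subst hd
      have : bracketPoly F κ e e' = 1 := by simp [bracketPoly, bracketForm, bracketTensor]
      rw [this]
      exact Submodule.subset_span rfl
    · have := h ⟨0, hN⟩
      omega
  obtain ⟨c, hc⟩ := Submodule.mem_span_singleton.mp (hle hmem)
  have heval : ∀ X : Fin m → Matrix (Fin n) (Fin n) F, evalMat X
      (bracketPoly F κ (Equiv.refl (Fin 1 × Fin n)) (Equiv.refl _)) = c := by
    intro X
    rw [← hc]
    simp
  have hc0 : c = 0 := by
    rw [← heval 0, evalMat_bracketPoly]
    refine Finset.sum_eq_zero fun i _ => Finset.sum_eq_zero fun j _ => ?_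
    rw [Finset.prod_eq_zero (Finset.mem_univ ((0, ⟨0, hn⟩) : Fin 1 × Fin n)) (by simp), mul_zero]
  have h1 := heval 1
  have h2 : ∀ i j : Fin 1 × Fin n → Fin n,
      ∏ s, (1 : Matrix (Fin n) (Fin n) F) (i s) (j s) = if i = j then 1 else 0 := by
    intro i j
    simp only [Matrix.one_apply, Finset.prod_ite_zero, Finset.prod_const_one, funext_iff,
      Finset.mem_univ, true_imp_iff]
  rw [evalMat_bracketPoly, hc0] at h1
  simp only [Pi.one_apply, h2, mul_ite, mul_one, mul_zero, Finset.sum_ite_eq, Finset.mem_univ,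
    if_true] at h1
  have h3 : 0 < ∑ i : Fin 1 × Fin n → Fin n,
      bracketTensor (Equiv.refl (Fin 1 × Fin n)) i * bracketTensor (Equiv.refl _) i := by
    refine Finset.sum_pos' (fun i _ => mul_self_nonneg _) ⟨Prod.snd, Finset.mem_univ _, ?_⟩
    simp [bracketTensor, leviCivita_id]
  refine h3.ne' ?_
  exact_mod_cast h1

end Counting

/-! ### Numerical estimates and conclusion. -/

theorem pow_le_three_pow_mul_factorial (d : ℕ) : (d : ℝ) ^ d ≤ 3 ^ d * d.factorial := by
  have h1 : (d : ℝ) ^ d / d.factorial ≤ Real.exp d :=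
    Real.pow_div_factorial_le_exp d (Nat.cast_nonneg d) d
  have h2 : Real.exp d ≤ 3 ^ d := by
    rw [← Real.exp_one_pow]
    exact pow_le_pow_left₀ (Real.exp_pos 1).le (Real.exp_one_lt_d9.le.trans (by norm_num)) d
  rw [div_le_iff₀ (by positivity)] at h1
  exact h1.trans (mul_le_mul_of_nonneg_right h2 (by positivity))

theorem le_mul_of_factorial_pow_le {d n T b : ℕ} (hd : 0 < d) (hdn : d * d ≤ n)
    (hT : d + T = n + 1) (h : (d.factorial ^ T) ^ 2 ≤ (d * (2 * b)) ^ (d * n)) :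
    d ≤ 72 * b := by
  have hd0 : (0 : ℝ) < d := by exact_mod_cast hd
  have h1 : ((d : ℝ) ^ d) ^ (2 * T) ≤ (9 ^ T * (2 * d * b) ^ n : ℝ) ^ d := by
    calc ((d : ℝ) ^ d) ^ (2 * T) ≤ (3 ^ d * d.factorial) ^ (2 * T) :=
          pow_le_pow_left₀ (by positivity) (pow_le_three_pow_mul_factorial d) _
      _ = (9 ^ T) ^ d * ((d.factorial ^ T) ^ 2 : ℕ) := by
          push_cast
          rw [mul_pow, ← pow_mul, ← pow_mul, ← pow_mul, show (9 : ℝ) = 3 ^ 2 by norm_num,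
            ← pow_mul]
          ring
      _ ≤ (9 ^ T) ^ d * ((d * (2 * b)) ^ (d * n) : ℕ) := by gcongr
      _ = (9 ^ T * (2 * d * b) ^ n : ℝ) ^ d := by
          rw [mul_pow (9 ^ T : ℝ), ← pow_mul _ n d, mul_comm n d,
            show (2 * d * b : ℝ) = d * (2 * b) by ring]
          push_cast
          rfl
  rw [← pow_mul, mul_comm d, pow_mul] at h1
  have h2 : (d : ℝ) ^ (2 * T) ≤ 9 ^ T * (2 * d * b) ^ n :=
    le_of_pow_le_pow_left₀ hd.ne' (by positivity) h1
  -- Replacing the exponent `2 * T` by `2 * n` costs at most `d ^ (2 * d)`; the choice `d * d ≤ n`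
  -- makes this exponential in `n`. The constant is then `72 = 9 * 2 * 4`.
  have h3 : (d : ℝ) ^ (2 * d) ≤ 4 ^ n := by
    calc (d : ℝ) ^ (2 * d) ≤ (2 ^ d) ^ (2 * d) := by
          gcongr
          exact_mod_cast Nat.lt_two_pow_self.le
      _ = 4 ^ (d * d) := by
          rw [← pow_mul, show (4 : ℝ) = 2 ^ 2 by norm_num, ← pow_mul]
          ring_nf
      _ ≤ 4 ^ n := pow_le_pow_right₀ (by norm_num) hdn
  have hn : 0 < n := lt_of_lt_of_le (Nat.mul_pos hd hd) hdn
  have h4 : ((d : ℝ) * d) ^ n ≤ (d * (72 * b)) ^ n := by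
    calc ((d : ℝ) * d) ^ n ≤ (d : ℝ) ^ (2 * T) * d ^ (2 * d) := by
          rw [← pow_add, ← sq, ← pow_mul]
          exact pow_le_pow_right₀ (by exact_mod_cast hd) (by omega)
      _ ≤ (9 ^ T * (2 * d * b) ^ n) * 4 ^ n := by gcongr
      _ ≤ (9 ^ n * (2 * d * b) ^ n) * 4 ^ n := by
          gcongr
          · norm_num
          · omega
      _ = (d * (72 * b)) ^ n := by
          rw [← mul_pow, ← mul_pow]
          ring
  have h5 := le_of_mul_le_mul_left (le_of_pow_le_pow_left₀ hn.ne' (by positivity) h4) hd0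
  exact_mod_cast h5

theorem sqrt_le_div_of_generatedInDegree {F : Type*} [Field F] [CharZero F] {n m D : ℕ}
    (hn : 0 < n) {δ : ℝ} (hδ : 0 < δ) (hδ1 : δ ≤ 1) (hm : δ * √n * n ≤ m)
    (h : GeneratedInDegree F n m D) : δ / 144 * √n ≤ (D / n : ℕ) := by
  have hn0 : (0 : ℝ) < n := by exact_mod_cast hn
  have hs : 0 < √(n : ℝ) := Real.sqrt_pos.mpr hn0
  have hm0 : 0 < m := by
    have : (0 : ℝ) < m := lt_of_lt_of_le (by positivity) hm
    exact_mod_cast this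
  have hb : (1 : ℝ) ≤ (D / n : ℕ) := by
    exact_mod_cast one_le_div_of_generatedInDegree hn hm0 h
  set d := ⌊δ * √(n : ℝ)⌋₊ with hd
  have hdle : (d : ℝ) ≤ δ * √n := Nat.floor_le (by positivity)
  have hlt : δ * √(n : ℝ) < d + 1 := Nat.lt_floor_add_one _
  -- When `d = 0` the counting is empty, but then `δ * √n < 1 ≤ D / n`.
  rcases Nat.eq_zero_or_pos d with h0 | hpos
  · rw [h0] at hlt
    push_cast at hlt
    linarith
  · have hd1 : (1 : ℝ) ≤ d := by exact_mod_cast hpos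
    have hdn : d * d ≤ n := by
      have h1 : (d : ℝ) ≤ √n := hdle.trans (mul_le_of_le_one_left hs.le hδ1)
      have h2 : (d : ℝ) * d ≤ n := by
        calc (d : ℝ) * d ≤ √n * √n := mul_le_mul h1 h1 (by positivity) hs.le
          _ = n := Real.mul_self_sqrt hn0.le
      exact_mod_cast h2
    have hdm : d * n ≤ m := by
      have : (d : ℝ) * n ≤ m := (mul_le_mul_of_nonneg_right hdle hn0.le).trans hm
      exact_mod_cast this
    have hdn' : d ≤ n := (Nat.le_mul_self d).trans hdn
    have hT : d + (n + 1 - d) = n + 1 := by omega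
    have key : (d : ℝ) ≤ 72 * (D / n : ℕ) := by
      exact_mod_cast le_mul_of_factorial_pow_le hpos hdn hT
        (factorial_pow_le_of_generatedInDegree hn h hT hdm)
    -- `δ * √n < d + 1 ≤ 2 * d ≤ 144 * (D / n)`, the source of the constant `144`.
    linarith

theorem mainTheorem3 (ε : ℝ) (hε : 0 < ε) :
    ∃ c : ℝ, 0 < c ∧ ∀ (F : Type*) [Field F] [CharZero F] (n m : ℕ),
      ε * (n : ℝ) ^ (3 / 2 : ℝ) ≤ (m : ℝ) →
        (∀ b : ℕ, GeneratedInDegree F n m (b * n) → c * (n : ℝ) ^ (1 / 2 : ℝ) ≤ (b : ℝ)) ∧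
        ENNReal.ofReal (c * (n : ℝ) ^ (3 / 2 : ℝ)) ≤ (betaSemiInv F n m : ℝ≥0∞) := by
  have hδ : 0 < min ε 1 := lt_min hε one_pos
  refine ⟨min ε 1 / 144, by positivity, fun F _ _ n m hm => ?_⟩
  rcases Nat.eq_zero_or_pos n with rfl | hn
  · constructor
    · intro b _
      simp
    · simp
  have hn0 : (0 : ℝ) < n := by exact_mod_cast hn
  have h32 : (n : ℝ) ^ (3 / 2 : ℝ) = √n * n := by
    rw [Real.sqrt_eq_rpow, ← Real.rpow_add_one hn0.ne']
    norm_num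
  rw [h32] at hm ⊢
  rw [← Real.sqrt_eq_rpow]
  have hm' : min ε 1 * √n * n ≤ m := by
    rw [mul_assoc]
    exact (mul_le_mul_of_nonneg_right (min_le_left _ _) (by positivity)).trans hm
  constructor
  · intro b hb
    have := sqrt_le_div_of_generatedInDegree hn hδ (min_le_right _ _) hm' hb
    rwa [Nat.mul_div_cancel _ hn] at this
  · have hle : ∀ D, GeneratedInDegree F n m D → min ε 1 / 144 * (√n * n) ≤ D := by
      intro D hD
      have h1 := sqrt_le_div_of_generatedInDegree hn hδ (min_le_right _ _) hm' hD
      rw [← mul_assoc]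
      refine (mul_le_mul_of_nonneg_right h1 hn0.le).trans ?_
      exact_mod_cast Nat.div_mul_le_self D n
    have hceil : ((⌈min ε 1 / 144 * (√n * n)⌉₊ : ℕ) : ℕ∞) ≤ betaSemiInv F n m :=
      le_iInf₂ fun D hD => by exact_mod_cast Nat.ceil_le.mpr (hle D hD)
    calc ENNReal.ofReal (min ε 1 / 144 * (√n * n))
        ≤ ((⌈min ε 1 / 144 * (√n * n)⌉₊ : ℕ) : ℝ≥0∞) := by
          rw [← ENNReal.ofReal_natCast]
          exact ENNReal.ofReal_le_ofReal (Nat.le_ceil _)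
      _ ≤ (betaSemiInv F n m : ℝ≥0∞) := by
          rw [← ENat.toENNReal_coe]
          exact ENat.toENNReal_le.mpr hceil
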